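/- Let $d \ge 0$ and $n \ge 1$ be integers, and let $E, F \subset \mathbb{R}^d$ be bands, i.e. measurable sets of finite Lebesgue measure $m(\cdot)$. Write $\hat f(\xi)=\int f(x)e^{-2\pi i x\cdot\xi}\,dx$ (extended to $L^2$) and $V_E = \{ f \in L^2(\mathbb{R}^d) : \hat f = 0 \text{ a.e. outside } E\}$; every $f \in V_E$ is identified with its continuous representative $f(y)=\int \hat f(\xi)e^{2\pi i y\cdot\xi}\,d\xi$. Let $A, B$ be invertible real $d\times d$ matrices and $\beta_1,\dots,\beta_n,\gamma_1,\dots,\gamma_n \in \mathbb{R}^d$. Suppose that the sampling transforms $$\Theta_A : V_E \to \bigoplus_{j=1}^n l^2(\mathbb{Z}^d),\quad f \mapsto \big((f(Az+\beta_j))_{z\in\mathbb{Z}^d}\big)_{j=1}^n, \qquad \Theta_B : V_F \to \bigoplus_{j=1}^n l^2(\mathbb{Z}^d),\quad g \mapsto \big((g(Bz+\gamma_j))_{z\in\mathbb{Z}^d}\big)_{j=1}^n$$ are well-defined bounded operators. The samples $\{Az+\beta_j\}$ and $\{Bz+\gamma_j\}$ are called orthogonal on $E$ and $F$ if $\Theta_A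 V_E \perp \Theta_B V_F$ in $\bigoplus_{j=1}^n l^2(\mathbb{Z}^d)$. Put $B' = (B^*)^{-1}$ and, for $q \in \mathbb{R}^d$, $J_q = \{ j \in \{1,\dots,n\} : B^{-1}\gamma_j - A^{-1}\beta_j = q\}$. Then the samples $\{Az+\beta_j : 1\le j\le n,\ z\in\mathbb{Z}^d\}$ and $\{Bz+\gamma_j : 1\le j\le n,\ z\in\mathbb{Z}^d\}$ are orthogonal on $E$ and $F$ if and only if for every $m \in \mathbb{Z}^d$ either 1. $m\big(A^*E \cap (B^*F + m)\big) = 0$, or 2. $\sum_{j\in J_q} e^{-2\pi i\, \gamma_j\cdot B' m} = 0$ for all $q\in\mathbb{R}^d$ (an empty sum is $0$). In particular, if the samples are orthogonal, then $m(A^*E\cap B^*F)=0$. -/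

import Mathlib

open MeasureTheory FourierTransform

noncomputable section

namespace LatticeSampling

/-- The space `ℝ^d` with the Euclidean inner product and Lebesgue measure. -/
abbrev Space (d : ℕ) : Type := EuclideanSpace ℝ (Fin d)

/-- The complex Hilbert space `L²(ℝ^d)`. -/
abbrev L2 (d : ℕ) : Type := Lp (α := Space d) ℂ 2

/-- The Hilbert space `l²(ℤ^d)`. -/
abbrev Seq (d : ℕ) : Type := lp (fun _ : Fin d → ℤ => ℂ) 2

/-- The Hilbert space direct sum of `n` copies of `l²(ℤ^d)`. -/
abbrev SeqSum (d n : ℕ) : Type := PiLp 2 (fun _ : Fin n => Seq d)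

/-- A point of `ℤ^d`, viewed in `ℝ^d`. -/
def intVec {d : ℕ} (z : Fin d → ℤ) : Space d := WithLp.toLp 2 (fun i => (z i : ℝ))

/-- The action of a real `d × d` matrix on `ℝ^d`. -/
def act {d : ℕ} (M : Matrix (Fin d) (Fin d) ℝ) (x : Space d) : Space d :=
  Matrix.toEuclideanLin M x

/-- A band is a measurable set of finite measure. -/
structure IsBand {d : ℕ} (E : Set (Space d)) : Prop where
  measurableSet : MeasurableSet E
  measure_lt_top : volume E < ⊤

/-- `V_E`: the functions in `L²(ℝ^d)` whose Fourier transform (with the normalization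
`∫ f(x) exp(-2πi x·ξ) dx`) vanishes almost everywhere outside `E`. -/
def bandSpace {d : ℕ} (E : Set (Space d)) : Submodule ℂ (L2 d) where
  carrier := {f | ∀ᵐ ξ : Space d, ξ ∉ E → (𝓕 f : L2 d) ξ = 0}
  add_mem' := by
    intro f g hf hg
    simp only [Set.mem_ofPred_eq, FourierTransform.fourier_add] at *
    filter_upwards [hf, hg, Lp.coeFn_add (𝓕 f : L2 d) (𝓕 g)] with ξ h1 h2 h3 hE
    rw [h3, Pi.add_apply, h1 hE, h2 hE, add_zero]
  zero_mem' := by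
    have h : (𝓕 (0 : L2 d) : L2 d) = 0 := (Lp.fourierTransformₗᵢ (Space d) ℂ).map_zero
    simp only [Set.mem_ofPred_eq, h]
    filter_upwards [Lp.coeFn_zero ℂ 2 (volume : Measure (Space d))] with ξ h1 _
    rw [h1, Pi.zero_apply]
  smul_mem' := by
    intro c f hf
    simp only [Set.mem_ofPred_eq, FourierTransform.fourier_smul] at *
    filter_upwards [hf, Lp.coeFn_smul c (𝓕 f : L2 d)] with ξ h1 h2 hE
    rw [h2, Pi.smul_apply, h1 hE, smul_zero]

/-- The point value `f(y)`, given by the inversion formula `∫ (𝓕 f)(ξ) exp(2πi y·ξ) dξ`. When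
`f ∈ V_E` and `E` is a band, `y ↦ pointValue f y` is the continuous representative of `f`, see
`continuous_pointValue` and `coeFn_ae_eq_pointValue`. -/
def pointValue {d : ℕ} (f : L2 d) (y : Space d) : ℂ :=
  𝓕⁻ (fun ξ : Space d => (𝓕 f : L2 d) ξ) y

theorem integrable_fourier_of_mem {d : ℕ} {E : Set (Space d)} (hE : IsBand E) {f : L2 d}
    (hf : f ∈ bandSpace E) : Integrable (fun ξ : Space d => (𝓕 f : L2 d) ξ) := by
  have h2 : IntegrableOn (fun ξ : Space d => (𝓕 f : L2 d) ξ) E := by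
    have : IsFiniteMeasure (volume.restrict E) := ⟨by simpa using hE.measure_lt_top⟩
    exact ((Lp.memLp (𝓕 f : L2 d)).restrict E).integrable (by norm_num)
  refine (h2.integrable_indicator hE.measurableSet).congr ?_
  have hf' : ∀ᵐ ξ : Space d, ξ ∉ E → (𝓕 f : L2 d) ξ = 0 := hf
  filter_upwards [hf'] with ξ h
  by_cases hξ : ξ ∈ E
  · simp [hξ]
  · simp [hξ, h hξ]

theorem continuous_pointValue {d : ℕ} {E : Set (Space d)} (hE : IsBand E) {f : L2 d}
    (hf : f ∈ bandSpace E) : Continuous (pointValue f) := by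
  have h := integrable_fourier_of_mem hE hf
  have h' : pointValue f = fun y => 𝓕 (fun ξ : Space d => (𝓕 f : L2 d) ξ) (-y) := by
    funext y
    exact Real.fourierInv_eq_fourier_neg _ y
  rw [h']
  exact (VectorFourier.fourierIntegral_continuous Real.continuous_fourierChar
    (by exact continuous_inner) h).comp continuous_neg

theorem coeFn_ae_eq_pointValue {d : ℕ} {E : Set (Space d)} (hE : IsBand E) {f : L2 d}
    (hf : f ∈ bandSpace E) : (fun y : Space d => f y) =ᵐ[volume] pointValue f := by
  have hint := integrable_fourier_of_mem hE hf
  refine ae_eq_of_integral_contDiff_smul_eq ?_ ?_ ?_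
  · exact (Lp.memLp f).locallyIntegrable (by norm_num)
  · exact (continuous_pointValue hE hf).locallyIntegrable
  intro g hg hgc
  have hc : HasCompactSupport (fun x => (g x : ℂ)) := hgc.comp_left Complex.ofReal_zero
  have hs : ContDiff ℝ (⊤ : ℕ∞) (fun x => (g x : ℂ)) :=
    Complex.ofRealCLM.contDiff.comp hg
  let u : SchwartzMap (Space d) ℂ := hc.toSchwartzMap hs
  have hu : ∀ x, u x = (g x : ℂ) := fun x => rfl
  have e1 := congrArg (fun T => T u) (Lp.fourierInv_toTemperedDistribution_eq (𝓕 f : L2 d))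
  simp only [FourierTransform.fourierInv_fourier_eq, TemperedDistribution.fourierInv_apply,
    Lp.toTemperedDistribution_apply] at e1
  have e2 : ∫ x, (𝓕⁻ u) x • (𝓕 f : L2 d) x = ∫ x, u x • pointValue f x := by
    have key := VectorFourier.integral_fourierIntegral_smul_eq_flip (μ := volume) (ν := volume)
      (f := fun x => u x) (g := fun ξ : Space d => (𝓕 f : L2 d) ξ) (L := -innerₗ (Space d))
      Real.continuous_fourierChar (by
        simp only [LinearMap.neg_apply, innerₗ_apply_apply]
        exact continuous_inner.neg) u.integrable hint
    have a1 : ∀ x, (𝓕⁻ u) x = VectorFourier.fourierIntegral Real.fourierChar volume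
        (-innerₗ (Space d)) (fun x => u x) x := by
      intro x
      rw [SchwartzMap.fourierInv_coe]
      rfl
    have a2 : ∀ x, pointValue f x = VectorFourier.fourierIntegral Real.fourierChar volume
        (-innerₗ (Space d)).flip (fun ξ : Space d => (𝓕 f : L2 d) ξ) x := by
      intro x
      simp only [pointValue, Real.fourierInv_eq, VectorFourier.fourierIntegral, LinearMap.flip_apply,
        LinearMap.neg_apply, innerₗ_apply_apply, neg_neg]
      congr 1
      funext ξ
      rw [real_inner_comm]
    simpa only [a1, a2] using key
  calc ∫ x, g x • f x = ∫ x, u x • f x := by simp [hu]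
    _ = ∫ x, u x • pointValue f x := by rw [← e2, ← e1]
    _ = ∫ x, g x • pointValue f x := by simp [hu]

/-- The samples `{A_j z + β_j : j = 1, …, n, z ∈ ℤ^d}` on the band `E` have a bounded sampling
transform: `f ↦ (f(A_1 z + β_1), …, f(A_n z + β_n))` is a bounded linear operator from `V_E` to the
direct sum of `n` copies of `l²(ℤ^d)`. -/
def SamplingBounded {d n : ℕ} (E : Set (Space d)) (A : Fin n → Matrix (Fin d) (Fin d) ℝ)
    (β : Fin n → Space d) : Prop :=
  ∃ Θ : bandSpace E →L[ℂ] SeqSum d n, ∀ (f : bandSpace E) (j : Fin n) (z : Fin d → ℤ),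
    Θ f j z = pointValue (f : L2 d) (act (A j) (intVec z) + β j)

/-- The sampling transform `Θ_A` (the operator is determined by its values). -/
def samplingTransform {d n : ℕ} {E : Set (Space d)} {A : Fin n → Matrix (Fin d) (Fin d) ℝ}
    {β : Fin n → Space d} (h : SamplingBounded E A β) : bandSpace E →L[ℂ] SeqSum d n :=
  h.choose

theorem samplingTransform_apply {d n : ℕ} {E : Set (Space d)}
    {A : Fin n → Matrix (Fin d) (Fin d) ℝ} {β : Fin n → Space d} (h : SamplingBounded E A β)
    (f : bandSpace E) (j : Fin n) (z : Fin d → ℤ) :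
    samplingTransform h f j z = pointValue (f : L2 d) (act (A j) (intVec z) + β j) :=
  h.choose_spec f j z

/-- The samples `{A_j z + β_j}` and `{B_j z + γ_j}`, whose sampling transforms are bounded on `E`
and `F`, are orthogonal on `E` and `F`: `Θ_A V_E ⟂ Θ_B V_F`. -/
def SamplesOrthogonal {d n : ℕ} {E F : Set (Space d)}
    {A B : Fin n → Matrix (Fin d) (Fin d) ℝ} {β γ : Fin n → Space d}
    (hA : SamplingBounded E A β) (hB : SamplingBounded F B γ) : Prop :=
  (samplingTransform hA).range ⟂ (samplingTransform hB).range

end LatticeSampling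

end

noncomputable section

namespace LatticeSampling

open Complex ComplexConjugate Filter Topology Pointwise

/-! Substituting `x = A^* ξ`, resp. `x = B^* ξ`, turns both lattices into `ℤ^d`, the offsets into
`a_j = A⁻¹ β_j` and `b_j = B⁻¹ γ_j`, and the bands into `A^* E` and `B^* F`; the transformed Fourier
transform of `f` is its `profile`. If the profiles of `f` and `g` live on the integer translates `k
+ Q` and `l + Q` of the unit cube, the samples are Fourier coefficients on `Q`, and Parseval gives,
up to a nonzero constant and with `m = k - l`, the inner product as the integral of `conj (f̂ x) * ĝ
(x - m) * P_m x`, where `P_m x = ∑_j e^{2πi (b_j - a_j)·x} e^{-2πi b_j·m}`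
(`inner_samplingTransform`).

Such `f` and `g` have dense span and the transforms are bounded, so orthogonality may be tested on
them (`functional_eq_zero_of_cube`, `samplesOrthogonal_iff`). It therefore says that every `P_m`
vanishes a.e. on `A^* E ∩ (B^* F + m)`. The coefficients of the trigonometric polynomial `P_m` are
the sums over `J_q`, and a trigonometric polynomial vanishing on a set of positive measure is zero
(`trigPoly_coeff_eq_zero`); this yields the two alternatives. -/

/-! ### Characters and integer vectors -/

/-- The character `x ↦ exp(2πi y·x)`. -/
def chr {d : ℕ} (y x : Space d) : ℂ := exp (2 * Real.pi * I * (inner ℝ y x : ℝ))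

theorem chr_add_left {d : ℕ} (y y' x : Space d) : chr (y + y') x = chr y x * chr y' x := by
  rw [chr, chr, chr, ← Complex.exp_add, inner_add_left]
  push_cast
  ring_nf

theorem chr_add_right {d : ℕ} (y x x' : Space d) : chr y (x + x') = chr y x * chr y x' := by
  rw [chr, chr, chr, ← Complex.exp_add, inner_add_right]
  push_cast
  ring_nf

theorem chr_ne_zero {d : ℕ} (y x : Space d) : chr y x ≠ 0 := Complex.exp_ne_zero _

theorem norm_chr {d : ℕ} (y x : Space d) : ‖chr y x‖ = 1 := by
  rw [chr, show 2 * (Real.pi : ℂ) * I * (inner ℝ y x : ℝ) = ((2 * Real.pi * inner ℝ y x : ℝ) : ℂ) * I by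
    push_cast; ring, Complex.norm_exp_ofReal_mul_I]

theorem conj_chr {d : ℕ} (y x : Space d) : conj (chr y x) = chr (-y) x := by
  rw [chr, chr, ← Complex.exp_conj]
  simp [Complex.conj_ofNat]

theorem chr_neg_right {d : ℕ} (y x : Space d) : chr y (-x) = chr (-y) x := by
  simp [chr]

@[simp] theorem chr_zero_right {d : ℕ} (x : Space d) : chr x 0 = 1 := by simp [chr]

theorem continuous_chr {d : ℕ} (y : Space d) : Continuous (chr y) := by
  unfold chr
  fun_prop

theorem intVec_sub {d : ℕ} (z k : Fin d → ℤ) : intVec (z - k) = intVec z - intVec k := by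
  ext i
  simp [intVec]

theorem intVec_zero {d : ℕ} : intVec (0 : Fin d → ℤ) = 0 := by
  ext i
  simp [intVec]

theorem chr_intVec_intVec {d : ℕ} (z k : Fin d → ℤ) : chr (intVec z) (intVec k) = 1 := by
  have h : (inner ℝ (intVec z) (intVec k) : ℝ) = ((∑ i, k i * z i : ℤ) : ℝ) := by
    simp [intVec, PiLp.inner_apply]
  rw [chr, h, Complex.exp_eq_one_iff]
  exact ⟨∑ i, k i * z i, by push_cast; ring⟩

/-! ### The tiling of space by integer translates of the unit cube -/

/-- The half-open unit cube. -/
def unitCube (d : ℕ) : Set (Space d) := {x | ∀ i, x i ∈ Set.Ioc (0 : ℝ) 1}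

theorem measurableSet_unitCube (d : ℕ) : MeasurableSet (unitCube d) := by
  have : unitCube d = ⋂ i, {x : Space d | x i ∈ Set.Ioc (0 : ℝ) 1} := by
    ext x; simp [unitCube]
  rw [this]
  exact MeasurableSet.iInter fun i => (by fun_prop : Measurable fun x : Space d => x i) measurableSet_Ioc

/-- The integer part of a point with respect to the half-open unit cube. -/
def cubeIndex {d : ℕ} (x : Space d) : Fin d → ℤ := fun i => ⌈x i⌉ - 1

/-- The cube is open on the left and closed on the right, as in `UnitAddTorus.measurableEquivPiIoc`,
which is why the index is the ceiling minus one and not the floor. -/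
theorem sub_intVec_mem_unitCube_iff {d : ℕ} (x : Space d) (k : Fin d → ℤ) :
    x - intVec k ∈ unitCube d ↔ cubeIndex x = k := by
  simp only [unitCube, Set.mem_ofPred_eq, intVec, PiLp.sub_apply, Set.mem_Ioc, funext_iff, cubeIndex]
  refine forall_congr' fun i => ?_
  rw [sub_eq_iff_eq_add, Int.ceil_eq_iff]
  push_cast
  constructor <;> rintro ⟨h1, h2⟩ <;> constructor <;> linarith

theorem measurable_cubeIndex {d : ℕ} : Measurable (cubeIndex (d := d)) := by
  unfold cubeIndex
  refine measurable_pi_lambda _ fun i => ?_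
  exact (Int.measurable_ceil.comp (by fun_prop : Measurable fun x : Space d => x i)).sub_const 1

/-! ### Linear independence of characters on sets of positive measure -/

/-- A Steinhaus argument: for a compact `K ⊆ S` of positive measure, the part of `t + K` outside `K`
has measure tending to zero, whereas a null overlap of `S` with its translate would make it as large
as `K`. -/
theorem exists_nhds_measure_inter_translate_ne_zero {d : ℕ} {S : Set (Space d)}
    (hS : MeasurableSet S) (h : volume S ≠ 0) :
    ∀ᶠ t in 𝓝 (0 : Space d), volume (S ∩ (fun x => x + t) ⁻¹' S) ≠ 0 := by
  obtain ⟨K, hKS, hK, hKpos⟩ := hS.exists_lt_isCompact (pos_iff_ne_zero.mpr h)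
  have ht := tendsto_measure_vadd_sdiff_isCompact_isClosed (μ := (volume : Measure (Space d))) hK
    hK.isClosed
  filter_upwards [(tendsto_order.1 ht).2 _ hKpos] with t ht0 h0
  have e1 : volume (t +ᵥ K) = volume K := measure_vadd _ _ _
  have e2 : volume ((t +ᵥ K) ∩ K) = 0 := by
    rw [← measure_vadd (volume : Measure (Space d)) (-t)]
    refine measure_mono_null ?_ h0
    rintro _ ⟨_, ⟨⟨x, hx, rfl⟩, hxt⟩, rfl⟩
    simp only [vadd_eq_add] at hxt ⊢
    refine ⟨?_, ?_⟩
    · simpa using hKS hx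
    · simpa [add_comm] using hKS hxt
  have := measure_le_inter_add_sdiff (volume : Measure (Space d)) (t +ᵥ K) K
  rw [e1, e2, zero_add] at this
  exact absurd ht0 (not_lt.2 this)

/-- A trigonometric polynomial that vanishes on a set of positive measure is zero. -/
theorem trigPoly_coeff_eq_zero {d : ℕ} (s : Finset (Space d)) :
    ∀ (c : Space d → ℂ) (S : Set (Space d)), MeasurableSet S → volume S ≠ 0 →
      (∀ x ∈ S, ∑ q ∈ s, c q * chr q x = 0) → ∀ q ∈ s, c q = 0 := by
  classical
  induction s using Finset.induction_on with
  | empty => simp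
  | insert p s hp ih =>
    intro c S hS hpos hvan
    -- With `f` the polynomial, `f (x + t) - chr p t * f x` has no `p` term, multiplies each other
    -- `c q` by `chr q t - chr p t`, and still vanishes on `S ∩ (S - t)`. The shift `t` is chosen
    -- for one `q` at a time.
    have hs : ∀ q ∈ s, c q = 0 := by
      intro q hq
      have hqp : q - p ≠ 0 := sub_ne_zero.2 fun h => hp (h ▸ hq)
      have hline : Tendsto (fun ε : ℝ => ε • (q - p)) (𝓝[>] 0) (𝓝 0) := by
        have : Continuous fun ε : ℝ => ε • (q - p) := by fun_prop
        simpa using (this.tendsto 0).mono_left nhdsWithin_le_nhds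
      have h1 := hline.eventually (exists_nhds_measure_inter_translate_ne_zero hS hpos)
      have hn : 0 < ‖q - p‖ ^ 2 := by positivity
      have h2 : ∀ᶠ ε : ℝ in 𝓝[>] 0, ε < 1 / ‖q - p‖ ^ 2 :=
        nhdsWithin_le_nhds (eventually_lt_nhds (by positivity))
      -- For such `ε` the number `(q - p)·t = ε ‖q - p‖²` lies strictly between 0 and 1, so it is no
      -- integer and `chr q t ≠ chr p t`.
      obtain ⟨ε, ⟨hε1, hε2⟩, hε0⟩ := ((h1.and h2).and self_mem_nhdsWithin).exists
      have hε0 : 0 < ε := hε0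
      set t := ε • (q - p) with ht
      have hvan' := ih (fun q => c q * (chr q t - chr p t)) _
        (hS.inter ((measurable_add_const t) hS)) hε1 ?_ q hq
      · rcases mul_eq_zero.1 hvan' with h | h
        · exact h
        · exfalso
          have h3 : chr (q - p) t = 1 := by
            have : chr q t = chr (q - p) t * chr p t := by rw [← chr_add_left, sub_add_cancel]
            rw [sub_eq_zero, this] at h
            exact mul_right_cancel₀ (chr_ne_zero p t) (h.trans (one_mul _).symm)
          rw [chr, Complex.exp_eq_one_iff] at h3
          obtain ⟨n, hn'⟩ := h3
          have h4 : (inner ℝ (q - p) t : ℝ) = n := by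
            have hne : (2 * (Real.pi : ℂ) * I) ≠ 0 := Complex.two_pi_I_ne_zero
            have : ((inner ℝ (q - p) t : ℝ) : ℂ) = n := by
              apply mul_left_cancel₀ hne
              rw [hn']; ring
            exact_mod_cast this
          rw [ht, inner_smul_right, real_inner_self_eq_norm_sq] at h4
          have h5 : (0 : ℝ) < n := by rw [← h4]; positivity
          have h6 : (n : ℝ) < 1 := by
            rw [← h4]
            exact (lt_div_iff₀ hn).1 hε2
          have h7 : (0 : ℤ) < n := by exact_mod_cast h5
          have h8 : n < (1 : ℤ) := by exact_mod_cast h6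
          omega
      · rintro x ⟨hx, hxt⟩
        have e1 := hvan x hx
        have e2 := hvan (x + t) hxt
        rw [Finset.sum_insert hp] at e1 e2
        have : ∑ q ∈ s, c q * (chr q t - chr p t) * chr q x
            = (c p * chr p (x + t) + ∑ q ∈ s, c q * chr q (x + t))
              - chr p t * (c p * chr p x + ∑ q ∈ s, c q * chr q x) := by
          have : ∑ q ∈ s, c q * (chr q t - chr p t) * chr q x
            = ∑ q ∈ s, c q * chr q (x + t) - chr p t * ∑ q ∈ s, c q * chr q x := by
            rw [Finset.mul_sum, ← Finset.sum_sub_distrib]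
            refine Finset.sum_congr rfl fun q _ => ?_
            rw [chr_add_right]; ring
          rw [this, chr_add_right]; ring
        rw [this, e1, e2]; ring
    intro q hq
    rcases Finset.mem_insert.1 hq with rfl | hq
    · obtain ⟨x, hx⟩ := nonempty_of_measure_ne_zero hpos
      have := hvan x hx
      rw [Finset.sum_insert hp, Finset.sum_eq_zero fun q hq => by rw [hs q hq, zero_mul], add_zero] at this
      exact (mul_eq_zero.1 this).resolve_right (chr_ne_zero _ _)
    · exact hs q hq

/-! ### Parseval's identity on the unit cube, transported from the torus -/

section Parseval

-- The Haar probability measure makes the torus monomials orthonormal.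
local instance : MeasureSpace UnitAddCircle := ⟨AddCircle.haarAddCircle⟩

/-- The section of the torus with values in the unit cube. -/
def torusSection {d : ℕ} (t : UnitAddTorus (Fin d)) : Space d :=
  WithLp.toLp 2 (UnitAddTorus.measurableEquivPiIoc 0 t).1

theorem measurePreserving_torusSection {d : ℕ} :
    MeasurePreserving (torusSection (d := d)) volume (volume.restrict (unitCube d)) := by
  have hm : MeasurableSet {x : Fin d → ℝ | ∀ i, x i ∈ Set.Ioc ((0 : Fin d → ℝ) i) ((0 : Fin d → ℝ) i + 1)} :=
    MeasurableSet.univ_pi' fun i => measurableSet_Ioc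
  have h1 := UnitAddTorus.measurePreserving_equivPiIoc (d := Fin d) 0
  have h2 : MeasurePreserving (Subtype.val : {x : Fin d → ℝ // ∀ i, x i ∈ Set.Ioc
      ((0 : Fin d → ℝ) i) ((0 : Fin d → ℝ) i + 1)} → Fin d → ℝ)
      (Measure.comap Subtype.val volume) (volume.restrict _) :=
    ⟨measurable_subtype_coe, map_comap_subtype_coe hm _⟩
  have h3 := (PiLp.volume_preserving_toLp (Fin d)).restrict_preimage (measurableSet_unitCube d)
  have h4 : (WithLp.toLp 2 ⁻¹' unitCube d : Set (Fin d → ℝ))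
      = {x : Fin d → ℝ | ∀ i, x i ∈ Set.Ioc ((0 : Fin d → ℝ) i) ((0 : Fin d → ℝ) i + 1)} := by
    ext x; simp [unitCube]
  rw [h4] at h3
  exact h3.comp (h2.comp h1)

theorem measurableEmbedding_torusSection {d : ℕ} : MeasurableEmbedding (torusSection (d := d)) := by
  have hm : MeasurableSet {x : Fin d → ℝ | ∀ i, x i ∈ Set.Ioc ((0 : Fin d → ℝ) i) ((0 : Fin d → ℝ) i + 1)} :=
    MeasurableSet.univ_pi' fun i => measurableSet_Ioc
  exact (MeasurableEquiv.toLp 2 (Fin d → ℝ)).measurableEmbedding.comp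
    ((MeasurableEmbedding.subtype_coe hm).comp
      (UnitAddTorus.measurableEquivPiIoc (0 : Fin d → ℝ)).measurableEmbedding)

theorem mFourier_eq_chr_torusSection {d : ℕ} (z : Fin d → ℤ) (t : UnitAddTorus (Fin d)) :
    UnitAddTorus.mFourier z t = chr (intVec z) (torusSection t) := by
  have ht : t = fun i => ((torusSection t i : ℝ) : UnitAddCircle) := by
    conv_lhs => rw [← (UnitAddTorus.measurableEquivPiIoc (0 : Fin d → ℝ)).symm_apply_apply t]
    rfl
  conv_lhs => rw [ht]
  simp only [UnitAddTorus.mFourier, ContinuousMap.coe_mk, fourier_coe_apply, chr, ← Complex.exp_sum]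
  congr 1
  simp only [intVec, PiLp.inner_apply, RCLike.inner_apply, conj_trivial]
  push_cast
  rw [Finset.mul_sum]
  refine Finset.sum_congr rfl fun i _ => ?_
  simp
  ring

/-- Parseval's identity for functions on the unit cube. -/
theorem hasSum_conj_mul_unitCube {d : ℕ} {u v : Space d → ℂ}
    (hu : MemLp u 2 (volume.restrict (unitCube d))) (hv : MemLp v 2 (volume.restrict (unitCube d))) :
    HasSum (fun z : Fin d → ℤ => conj (∫ x in unitCube d, chr (intVec z) x * u x) *
      ∫ x in unitCube d, chr (intVec z) x * v x) (∫ x in unitCube d, conj (u x) * v x) := by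
  have hmp := measurePreserving_torusSection (d := d)
  have hme := measurableEmbedding_torusSection (d := d)
  have coeff : ∀ {w : Space d → ℂ} (hw : MemLp w 2 (volume.restrict (unitCube d))) (z : Fin d → ℤ),
      UnitAddTorus.mFourierCoeff ((hw.comp_measurePreserving hmp).toLp _) (-z)
        = ∫ x in unitCube d, chr (intVec z) x * w x := by
    intro w hw z
    rw [← hmp.integral_comp hme, UnitAddTorus.mFourierCoeff]
    refine integral_congr_ae ?_
    filter_upwards [(hw.comp_measurePreserving hmp).coeFn_toLp] with t ht
    rw [ht, neg_neg, mFourier_eq_chr_torusSection, smul_eq_mul, Function.comp]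
  have key := UnitAddTorus.hasSum_prod_mFourierCoeff ((hu.comp_measurePreserving hmp).toLp _)
    ((hv.comp_measurePreserving hmp).toLp _)
  -- The integral against `chr (intVec z)` is the coefficient of index `-z`, so the sum is reindexed
  -- by negation.
  rw [← (Equiv.neg (Fin d → ℤ)).hasSum_iff] at key
  simp only [Function.comp_def, Equiv.neg_apply] at key
  simp only [← coeff hu, ← coeff hv, Function.comp_def]
  convert key using 1
  rw [← hmp.integral_comp hme]
  refine integral_congr_ae ?_
  filter_upwards [(hu.comp_measurePreserving hmp).coeFn_toLp,
    (hv.comp_measurePreserving hmp).coeFn_toLp] with t h1 h2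
  exact (congrArg₂ (fun a b => conj a * b) h1 h2).symm

end Parseval

/-! ### Linear changes of variables -/

section Act

variable {d : ℕ} (M N : Matrix (Fin d) (Fin d) ℝ)

theorem act_add (x y : Space d) : act M (x + y) = act M x + act M y :=
  map_add (Matrix.toEuclideanLin M) x y

theorem act_act (x : Space d) : act M (act N x) = act (M * N) x := by
  simp [act, Matrix.toLpLin_apply]

theorem act_one (x : Space d) : act 1 x = x := by
  simp [act]

theorem inner_act (x y : Space d) : (inner ℝ x (act M y) : ℝ) = inner ℝ (act M.transpose x) y := by
  have := LinearMap.adjoint_inner_left (Matrix.toEuclideanLin M) y x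
  rw [← Matrix.toEuclideanLin_conjTranspose_eq_adjoint] at this
  rw [act, ← this, act, Matrix.conjTranspose_eq_transpose_of_trivial]

variable {M}

theorem act_inv_act (hM : IsUnit M) (x : Space d) : act M⁻¹ (act M x) = x := by
  rw [act_act, Matrix.nonsing_inv_mul _ ((Matrix.isUnit_iff_isUnit_det M).1 hM), act_one]

theorem act_act_inv (hM : IsUnit M) (x : Space d) : act M (act M⁻¹ x) = x := by
  rw [act_act, Matrix.mul_nonsing_inv _ ((Matrix.isUnit_iff_isUnit_det M).1 hM), act_one]

theorem mem_act_image_iff (hM : IsUnit M) (S : Set (Space d)) (x : Space d) :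
    x ∈ act M '' S ↔ act M⁻¹ x ∈ S := by
  constructor
  · rintro ⟨y, hy, rfl⟩
    rwa [act_inv_act hM]
  · exact fun h => ⟨_, h, act_act_inv hM x⟩

theorem continuous_act (M : Matrix (Fin d) (Fin d) ℝ) : Continuous (act M) :=
  (Matrix.toEuclideanLin M).continuous_of_finiteDimensional

theorem measurableEmbedding_act (hM : IsUnit M) : MeasurableEmbedding (act M) :=
  (MeasurableEquiv.mk ⟨act M, act M⁻¹, act_inv_act hM, act_act_inv hM⟩
    (continuous_act M).measurable (continuous_act M⁻¹).measurable).measurableEmbedding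

theorem det_toEuclideanLin (M : Matrix (Fin d) (Fin d) ℝ) :
    LinearMap.det (Matrix.toEuclideanLin M) = M.det := by
  rw [← LinearMap.det_toLin (PiLp.basisFun 2 ℝ (Fin d)) M, ← Matrix.toLpLin_eq_toLin]

theorem map_act_volume (hM : IsUnit M) :
    Measure.map (act M) volume = ENNReal.ofReal |M.det⁻¹| • (volume : Measure (Space d)) := by
  have h := Measure.map_linearMap_addHaar_eq_smul_addHaar (μ := (volume : Measure (Space d)))
    (f := Matrix.toEuclideanLin M) (by
      rw [det_toEuclideanLin]; exact ((Matrix.isUnit_iff_isUnit_det M).1 hM).ne_zero)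
  rwa [det_toEuclideanLin] at h

theorem integral_eq_integral_act (hM : IsUnit M) (g : Space d → ℂ) :
    ∫ x, g x = (|M.det| : ℝ) * ∫ x, g (act M x) := by
  have h := (measurableEmbedding_act hM).integral_map (μ := volume) g
  have h0 : M.det ≠ 0 := ((Matrix.isUnit_iff_isUnit_det M).1 hM).ne_zero
  rw [← h, map_act_volume hM, integral_smul_measure, ENNReal.toReal_ofReal (abs_nonneg _),
    Complex.real_smul, ← mul_assoc, ← Complex.ofReal_mul, abs_inv, mul_inv_cancel₀ (abs_ne_zero.2 h0)]
  simp

theorem quasiMeasurePreserving_act (hM : IsUnit M) :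
    Measure.QuasiMeasurePreserving (act M) (volume : Measure (Space d)) volume :=
  ⟨(continuous_act M).measurable, by
    rw [map_act_volume hM]; exact Measure.smul_absolutelyContinuous⟩

theorem memLp_comp_act (hM : IsUnit M) {u : Space d → ℂ} (hu : MemLp u 2) :
    MemLp (fun x => u (act M x)) 2 := by
  have h : MemLp u 2 (Measure.map (act M) volume) := by
    rw [map_act_volume hM]
    exact hu.smul_measure ENNReal.ofReal_ne_top
  exact h.comp_of_map (continuous_act M).aemeasurable

theorem isUnit_transpose_inv (hM : IsUnit M) : IsUnit (M.transpose)⁻¹ :=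
  Matrix.isUnit_nonsing_inv_iff.2 ((Matrix.isUnit_transpose M).2 hM)

end Act

/-! ### Profiles, and inner products of samples -/

/-- The Fourier transform of `f` in the coordinates in which sampling on `M ℤ^d` is sampling
on `ℤ^d`. -/
def profile {d : ℕ} (M : Matrix (Fin d) (Fin d) ℝ) (f : L2 d) (x : Space d) : ℂ :=
  (𝓕 f : L2 d) (act (M.transpose)⁻¹ x)

section Profile

variable {d : ℕ} {M : Matrix (Fin d) (Fin d) ℝ}

theorem memLp_profile (hM : IsUnit M) (f : L2 d) : MemLp (profile M f) 2 :=
  memLp_comp_act (isUnit_transpose_inv hM) (Lp.memLp (𝓕 f : L2 d))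

theorem profile_eq_zero (hM : IsUnit M) {E : Set (Space d)} {f : L2 d} (hf : f ∈ bandSpace E) :
    ∀ᵐ x, x ∉ act M.transpose '' E → profile M f x = 0 := by
  have hf' : ∀ᵐ ξ : Space d, ξ ∉ E → (𝓕 f : L2 d) ξ = 0 := hf
  filter_upwards [(quasiMeasurePreserving_act (isUnit_transpose_inv hM)).ae hf'] with x hx h
  exact hx (by rwa [mem_act_image_iff ((Matrix.isUnit_transpose M).2 hM)] at h)

/-- The Fourier transform maps onto `L²`, so profiles can be prescribed freely on the transformed
band; this supplies the test functions. -/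
theorem exists_profile_eq (hM : IsUnit M) {E : Set (Space d)} {w : Space d → ℂ} (hw : MemLp w 2)
    (hE : ∀ x, x ∉ act M.transpose '' E → w x = 0) :
    ∃ f : bandSpace E, profile M (f : L2 d) =ᵐ[volume] w := by
  have hMt := (Matrix.isUnit_transpose M).2 hM
  have hw' := memLp_comp_act hMt hw
  let h : L2 d := hw'.toLp _
  have hF : (𝓕 (𝓕⁻ h : L2 d) : L2 d) = h := FourierTransform.fourier_fourierInv_eq h
  refine ⟨⟨𝓕⁻ h, ?_⟩, ?_⟩
  · change ∀ᵐ ξ : Space d, ξ ∉ E → (𝓕 (𝓕⁻ h : L2 d) : L2 d) ξ = 0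
    rw [hF]
    filter_upwards [hw'.coeFn_toLp] with ξ h1 h2
    rw [h1]
    exact hE _ fun h3 => h2 (by rwa [mem_act_image_iff hMt, act_inv_act hMt] at h3)
  · filter_upwards [(quasiMeasurePreserving_act (isUnit_transpose_inv hM)).ae hw'.coeFn_toLp] with x hx
    rw [profile, hF, hx, act_act_inv hMt]

theorem inner_eq_integral_profile (hM : IsUnit M) (f g : L2 d) :
    inner ℂ f g = (|(M.transpose)⁻¹.det| : ℝ) * ∫ x, conj (profile M f x) * profile M g x := by
  have h1 : inner ℂ f g = inner ℂ (𝓕 f : L2 d) (𝓕 g : L2 d) :=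
    ((Lp.fourierTransformₗᵢ (Space d) ℂ).inner_map_map f g).symm
  rw [h1, L2.inner_def, integral_eq_integral_act (isUnit_transpose_inv hM)]
  simp only [RCLike.inner_apply, profile, mul_comm]

/-- The substitution `ξ = (Mᵀ)⁻¹ x` turns `(M z + β)·ξ` into `(z + M⁻¹ β)·x`. -/
theorem pointValue_eq_integral_profile (hM : IsUnit M) (f : L2 d) (z β : Space d) :
    pointValue f (act M z + β) = (|(M.transpose)⁻¹.det| : ℝ) *
      ∫ x, chr (z + act M⁻¹ β) x * profile M f x := by
  rw [pointValue, Real.fourierInv_eq', integral_eq_integral_act (isUnit_transpose_inv hM)]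
  congr 2
  funext x
  rw [smul_eq_mul, profile, chr, real_inner_comm, inner_act, act_add, Matrix.transpose_nonsing_inv,
    Matrix.transpose_transpose, act_inv_act hM]
  push_cast
  ring_nf

theorem integral_eq_setIntegral_unitCube_add {k : Fin d → ℤ} {g : Space d → ℂ}
    (hg : ∀ᵐ x, cubeIndex x ≠ k → g x = 0) :
    ∫ x, g x = ∫ x in unitCube d, g (x + intVec k) := by
  rw [← integral_add_right_eq_self g (intVec k)]
  refine (setIntegral_eq_integral_of_ae_compl_eq_zero ?_).symm
  filter_upwards [(measurePreserving_add_right volume (intVec k)).quasiMeasurePreserving.ae hg]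
    with x hx hxQ
  refine hx fun h => hxQ ?_
  have := (sub_intVec_mem_unitCube_iff (x + intVec k) k).2 h
  rwa [add_sub_cancel_right] at this

theorem memLp_chr_mul {u : Space d → ℂ} {μ : Measure (Space d)} (hu : MemLp u 2 μ) (y : Space d) :
    MemLp (fun x => chr y x * u x) 2 μ :=
  hu.of_le ((continuous_chr y).aestronglyMeasurable.mul hu.1)
    (ae_of_all _ fun x => by rw [norm_mul, norm_chr, one_mul])

theorem memLp_add_right {u : Space d → ℂ} (hu : MemLp u 2) (y : Space d) :
    MemLp (fun x => u (x + y)) 2 :=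
  hu.comp_measurePreserving (measurePreserving_add_right volume y)

/-- Since each profile occupies a single cube, no periodization sum appears: the samples are Fourier
coefficients of one function on the cube, and Parseval applies. Integer translations do not affect
`chr (intVec z)`; moving the cube `l` onto the cube `k` costs only the phase `chr (-b) (intVec (k -
l))`. -/
theorem hasSum_conj_mul_pointValue {A B : Matrix (Fin d) (Fin d) ℝ} (hA : IsUnit A) (hB : IsUnit B)
    {f g : L2 d} {k l : Fin d → ℤ} (hf : ∀ᵐ x, cubeIndex x ≠ k → profile A f x = 0)
    (hg : ∀ᵐ x, cubeIndex x ≠ l → profile B g x = 0) (β γ : Space d) :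
    HasSum (fun z : Fin d → ℤ => conj (pointValue f (act A (intVec z) + β)) *
        pointValue g (act B (intVec z) + γ))
      (((|(A.transpose)⁻¹.det| : ℝ) * (|(B.transpose)⁻¹.det| : ℝ)) *
        ∫ x, conj (profile A f x) * profile B g (x - intVec (k - l)) *
          (chr (act B⁻¹ γ - act A⁻¹ β) x * chr (-act B⁻¹ γ) (intVec (k - l)))) := by
  set a := act A⁻¹ β
  set b := act B⁻¹ γ
  have coeff : ∀ {M : Matrix (Fin d) (Fin d) ℝ} (hM : IsUnit M) {h : L2 d} {k : Fin d → ℤ}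
      (hh : ∀ᵐ x, cubeIndex x ≠ k → profile M h x = 0) (β : Space d) (z : Fin d → ℤ),
      pointValue h (act M (intVec z) + β) = (|(M.transpose)⁻¹.det| : ℝ) *
        ∫ x in unitCube d, chr (intVec z) x *
          (chr (act M⁻¹ β) (x + intVec k) * profile M h (x + intVec k)) := by
    intro M hM h k hh β z
    rw [pointValue_eq_integral_profile hM, integral_eq_setIntegral_unitCube_add (k := k)]
    · congr 2
      funext x
      rw [chr_add_left, chr_add_right (intVec z), chr_intVec_intVec]
      ring
    · filter_upwards [hh] with x hx hxk
      rw [hx hxk, mul_zero]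
  have key := hasSum_conj_mul_unitCube
    ((memLp_add_right (memLp_chr_mul (memLp_profile hA f) a) (intVec k)).restrict (unitCube d))
    ((memLp_add_right (memLp_chr_mul (memLp_profile hB g) b) (intVec l)).restrict (unitCube d))
  have key2 := key.mul_left (((|(A.transpose)⁻¹.det| : ℝ) : ℂ) * (|(B.transpose)⁻¹.det| : ℝ))
  convert! key2 using 1
  · funext z
    rw [coeff hA hf, coeff hB hg, map_mul, Complex.conj_ofReal]
    ring
  · rw [integral_eq_setIntegral_unitCube_add (k := k)]
    · congr 2
      funext x
      have e1 : x + intVec k - intVec (k - l) = x + intVec l := by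
        rw [intVec_sub]; abel
      have e2 : chr b (x + intVec l) = chr b (x + intVec k) * chr (-b) (intVec (k - l)) := by
        rw [← chr_neg_right, ← chr_add_right, intVec_sub]
        congr 1; abel
      rw [e1, map_mul, conj_chr, e2, sub_eq_add_neg, chr_add_left]
      ring
    · filter_upwards [hf] with x hx hxk
      rw [hx hxk, map_zero, zero_mul, zero_mul]

/-- The trigonometric polynomial whose coefficients are sums of the phases
`exp(-2πi b_j·m)` over the indices with equal offset `b_j - a_j`. -/
def phaseSum {n : ℕ} (a b : Fin n → Space d) (m : Fin d → ℤ) (x : Space d) : ℂ :=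
  ∑ j, chr (b j - a j) x * chr (-b j) (intVec m)

theorem continuous_phaseSum {n : ℕ} (a b : Fin n → Space d) (m : Fin d → ℤ) :
    Continuous (phaseSum a b m) :=
  continuous_finsetSum _ fun _ _ => (continuous_chr _).mul continuous_const

theorem norm_phaseSum_le {n : ℕ} (a b : Fin n → Space d) (m : Fin d → ℤ) (x : Space d) :
    ‖phaseSum a b m x‖ ≤ n := by
  refine (norm_sum_le _ _).trans ?_
  simp [norm_chr]

/-- Grouping equal offsets makes the frequencies distinct, so that the sums over `J_q` become
genuine coefficients. -/
theorem phaseSum_eq_sum_image {n : ℕ} (a b : Fin n → Space d) (m : Fin d → ℤ) (x : Space d) :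
    phaseSum a b m x = ∑ q ∈ Finset.univ.image (fun j => b j - a j),
      (∑ j : Fin n with b j - a j = q, chr (-b j) (intVec m)) * chr q x := by
  rw [phaseSum, ← Finset.sum_fiberwise_of_maps_to
    (fun j _ => Finset.mem_image_of_mem (fun j => b j - a j) (Finset.mem_univ j))]
  refine Finset.sum_congr rfl fun q _ => ?_
  rw [Finset.sum_mul]
  refine Finset.sum_congr rfl fun j hj => ?_
  rw [(Finset.mem_filter.1 hj).2, mul_comm]

theorem inner_samplingTransform {n : ℕ} {E F : Set (Space d)} {A B : Matrix (Fin d) (Fin d) ℝ}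
    (hA : IsUnit A) (hB : IsUnit B) {β γ : Fin n → Space d}
    (hΘA : SamplingBounded E (fun _ => A) β) (hΘB : SamplingBounded F (fun _ => B) γ)
    {f : bandSpace E} {g : bandSpace F} {k l : Fin d → ℤ}
    (hf : ∀ᵐ x, cubeIndex x ≠ k → profile A (f : L2 d) x = 0)
    (hg : ∀ᵐ x, cubeIndex x ≠ l → profile B (g : L2 d) x = 0) :
    inner ℂ (samplingTransform hΘA f) (samplingTransform hΘB g) =
      ((|(A.transpose)⁻¹.det| : ℝ) * (|(B.transpose)⁻¹.det| : ℝ)) *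
        ∫ x, conj (profile A (f : L2 d) x) * profile B (g : L2 d) (x - intVec (k - l)) *
          phaseSum (fun j => act A⁻¹ (β j)) (fun j => act B⁻¹ (γ j)) (k - l) x := by
  simp only [phaseSum, Finset.mul_sum]
  rw [integral_finsetSum, Finset.mul_sum, PiLp.inner_apply]
  · refine Finset.sum_congr rfl fun j _ => ?_
    have h1 := lp.hasSum_inner (𝕜 := ℂ) (samplingTransform hΘA f j) (samplingTransform hΘB g j)
    refine h1.unique ?_
    convert! hasSum_conj_mul_pointValue hA hB hf hg (β j) (γ j) using 1
    funext z
    rw [samplingTransform_apply, samplingTransform_apply, RCLike.inner_apply, mul_comm]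
  · intro j _
    have h1 := (memLp_profile hA (f : L2 d)).star
    have h2 := memLp_add_right (memLp_profile hB (g : L2 d)) (-intVec (k - l))
    refine (h1.integrable_mul h2).mul_bdd (c := 1) ?_ (ae_of_all _ fun x => ?_)
    · exact ((continuous_chr _).mul continuous_const).aestronglyMeasurable
    · rw [norm_mul, norm_chr, norm_chr, one_mul]

end Profile

/-! ### Reduction to single cubes, and the criterion -/

section Orthogonality

variable {d n : ℕ} {E F : Set (Space d)} {A B : Matrix (Fin d) (Fin d) ℝ}

/-- A continuous functional on `V_E` vanishes if it does on all functions whose profile lives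
on one integer translate of the unit cube. -/
theorem functional_eq_zero_of_cube (hE : IsBand E) (hA : IsUnit A) (φ : bandSpace E →L[ℂ] ℂ)
    (hφ : ∀ (k : Fin d → ℤ) (f : bandSpace E),
      (∀ᵐ x, cubeIndex x ≠ k → profile A (f : L2 d) x = 0) → φ f = 0) (f : bandSpace E) :
    φ f = 0 := by
  have hAt := (Matrix.isUnit_transpose A).2 hA
  -- The kernel is placed in the complete space `L²`, where its double orthogonal complement is its
  -- closure.
  set N : Submodule ℂ (L2 d) := φ.ker.map (bandSpace E).subtype with hN
  have hEm : MeasurableSet (act A.transpose '' E) :=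
    (measurableEmbedding_act hAt).measurableSet_image.2 hE.measurableSet
  have hfN : (f : L2 d) ∈ Nᗮᗮ := by
    rw [Submodule.mem_orthogonal]
    intro h hh
    have hzero : ∀ᵐ x, x ∈ act A.transpose '' E → profile A h x = 0 := by
      have hk : ∀ k : Fin d → ℤ, ∀ᵐ x, x ∈ act A.transpose '' E ∩ cubeIndex ⁻¹' {k} →
          profile A h x = 0 := by
        intro k
        have hS : MeasurableSet (act A.transpose '' E ∩ cubeIndex ⁻¹' {k}) :=
          hEm.inter (measurable_cubeIndex (measurableSet_singleton k))
        -- Testing `h ⟂ N` against the cutoff of the profile of `h` itself gives `∫ |profile A h|² =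
        -- 0` over this piece.
        obtain ⟨g, hg⟩ := exists_profile_eq hA (E := E) ((memLp_profile hA h).indicator hS)
          (fun x hx => Set.indicator_of_notMem (fun hx' => hx hx'.1) _)
        have hgN : (g : L2 d) ∈ N := by
          refine Submodule.mem_map.2 ⟨g, ?_, rfl⟩
          refine hφ k g ?_
          filter_upwards [hg] with x hx hxk
          rw [hx]
          exact Set.indicator_of_notMem (fun hx' => hxk hx'.2) _
        have h0 := (Submodule.mem_orthogonal N h).1 hh _ hgN
        rw [inner_eq_integral_profile hA] at h0
        have h1 : ∫ x, conj (profile A (g : L2 d) x) * profile A h x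
            = ((∫ x in act A.transpose '' E ∩ cubeIndex ⁻¹' {k}, ‖profile A h x‖ ^ 2 : ℝ) : ℂ) := by
          rw [← integral_complex_ofReal, ← integral_indicator hS]
          refine integral_congr_ae ?_
          filter_upwards [hg] with x hx
          rw [hx]
          by_cases hxS : x ∈ act A.transpose '' E ∩ cubeIndex ⁻¹' {k}
          · simp [Set.indicator_of_mem hxS, Complex.conj_mul']
          · simp [Set.indicator_of_notMem hxS]
        have hdet : ((|(A.transpose)⁻¹.det| : ℝ) : ℂ) ≠ 0 := by
          simpa using ((Matrix.isUnit_iff_isUnit_det _).1 (isUnit_transpose_inv hA)).ne_zero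
        have h2 := (mul_eq_zero.1 h0).resolve_left hdet
        rw [h1, Complex.ofReal_eq_zero, integral_eq_zero_iff_of_nonneg (fun x => sq_nonneg _)
          ((memLp_profile hA h).restrict _).norm.integrable_sq] at h2
        rw [← ae_restrict_iff' hS]
        filter_upwards [h2] with x hx
        simpa using hx
      filter_upwards [ae_all_iff.2 hk] with x hx hxE
      exact hx (cubeIndex x) ⟨hxE, rfl⟩
    rw [inner_eq_integral_profile hA, integral_eq_zero_of_ae, mul_zero]
    filter_upwards [hzero, profile_eq_zero hA f.2] with x h1 h2
    by_cases hx : x ∈ act A.transpose '' E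
    · simp [h1 hx]
    · simp [h2 hx]
  rw [Submodule.orthogonal_orthogonal_eq_closure, ← SetLike.mem_coe,
    Submodule.topologicalClosure_coe, mem_closure_iff_seq_limit] at hfN
  obtain ⟨y, hy, hlim⟩ := hfN
  choose x hx hxy using fun i => Submodule.mem_map.1 (hy i)
  have hlim' : Tendsto x atTop (𝓝 f) := by
    rw [tendsto_subtype_rng]
    convert hlim using 2
    exact hxy _
  refine tendsto_nhds_unique ((φ.continuous.tendsto f).comp hlim') ?_
  have : φ ∘ x = fun _ => 0 := funext fun i => hx i
  rw [this]
  exact tendsto_const_nhds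

/-- Boundedness of the transforms makes the inner product continuous in each argument, so the
reduction to one cube applies to `f` and to `g` separately. -/
theorem samplesOrthogonal_iff (hE : IsBand E) (hF : IsBand F) (hA : IsUnit A) (hB : IsUnit B)
    {β γ : Fin n → Space d} (hΘA : SamplingBounded E (fun _ => A) β)
    (hΘB : SamplingBounded F (fun _ => B) γ) :
    SamplesOrthogonal hΘA hΘB ↔ ∀ (k l : Fin d → ℤ) (f : bandSpace E) (g : bandSpace F),
      (∀ᵐ x, cubeIndex x ≠ k → profile A (f : L2 d) x = 0) →
      (∀ᵐ x, cubeIndex x ≠ l → profile B (g : L2 d) x = 0) →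
      inner ℂ (samplingTransform hΘA f) (samplingTransform hΘB g) = 0 := by
  constructor
  · intro h k l f g _ _
    exact Submodule.isOrtho_iff_inner_eq.1 h _ ⟨f, rfl⟩ _ ⟨g, rfl⟩
  · intro h
    refine Submodule.isOrtho_iff_inner_eq.2 ?_
    rintro _ ⟨f, rfl⟩ _ ⟨g, rfl⟩
    refine functional_eq_zero_of_cube hF hB
      ((innerSL ℂ (samplingTransform hΘA f)).comp (samplingTransform hΘB)) (fun l g hg => ?_) g
    -- The inner product is conjugate-linear in its first argument, so the arguments are swapped to
    -- obtain a linear functional of `f`.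
    have hfg : inner ℂ (samplingTransform hΘB g) (samplingTransform hΘA f) = 0 :=
      functional_eq_zero_of_cube hE hA
        ((innerSL ℂ (samplingTransform hΘB g)).comp (samplingTransform hΘA))
        (fun k f hf => inner_eq_zero_symm.1 (h k l f g hf hg)) f
    exact inner_eq_zero_symm.1 hfg

theorem mem_translate_iff (S : Set (Space d)) (v x : Space d) :
    x ∈ (fun x => x + v) '' S ↔ x - v ∈ S := by
  constructor
  · rintro ⟨y, hy, rfl⟩
    simpa using hy
  · exact fun h => ⟨_, h, sub_add_cancel _ _⟩

/-- Orthogonality forces the phase polynomial to vanish almost everywhere on the overlap. -/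
theorem SamplesOrthogonal.phaseSum_ae_eq_zero (hE : IsBand E) (hF : IsBand F) (hA : IsUnit A)
    (hB : IsUnit B) {β γ : Fin n → Space d} {hΘA : SamplingBounded E (fun _ => A) β}
    {hΘB : SamplingBounded F (fun _ => B) γ} (h : SamplesOrthogonal hΘA hΘB) (m : Fin d → ℤ) :
    ∀ᵐ x, x ∈ act A.transpose '' E ∩ (fun x => x + intVec m) '' (act B.transpose '' F) →
      phaseSum (fun j => act A⁻¹ (β j)) (fun j => act B⁻¹ (γ j)) m x = 0 := by
  have hAt := (Matrix.isUnit_transpose A).2 hA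
  have hBt := (Matrix.isUnit_transpose B).2 hB
  set P := phaseSum (fun j => act A⁻¹ (β j)) (fun j => act B⁻¹ (γ j)) m with hP
  have hPc : Continuous P := continuous_phaseSum _ _ _
  have hEm : MeasurableSet (act A.transpose '' E) :=
    (measurableEmbedding_act hAt).measurableSet_image.2 hE.measurableSet
  have hFm : MeasurableSet ((fun x => x + intVec m) '' (act B.transpose '' F)) :=
    (measurableEmbedding_addRight (intVec m)).measurableSet_image.2
      ((measurableEmbedding_act hBt).measurableSet_image.2 hF.measurableSet)
  have hEfin : volume (act A.transpose '' E) < ⊤ := by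
    have himg : volume (act A.transpose '' E) = _ :=
      Measure.addHaar_image_linearMap volume (Matrix.toEuclideanLin A.transpose) E
    rw [himg]
    exact ENNReal.mul_lt_top ENNReal.ofReal_lt_top hE.measure_lt_top
  have hk : ∀ k : Fin d → ℤ, ∀ᵐ x, x ∈ (act A.transpose '' E ∩
      (fun x => x + intVec m) '' (act B.transpose '' F)) ∩ cubeIndex ⁻¹' {k} → P x = 0 := by
    intro k
    set S := (act A.transpose '' E ∩
      (fun x => x + intVec m) '' (act B.transpose '' F)) ∩ cubeIndex ⁻¹' {k} with hSdef
    have hS : MeasurableSet S :=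
      (hEm.inter hFm).inter (measurable_cubeIndex (measurableSet_singleton k))
    have hSfin : volume S < ⊤ := (measure_mono fun x hx => hx.1.1).trans_lt hEfin
    have hfinite : IsFiniteMeasure (volume.restrict S) := ⟨by simpa using hSfin⟩
    -- The test pair has profile `1_S` for `f` and, for `g`, `conj P * 1_S` moved back by `m` into
    -- the cube `k - m`; the integral then becomes `∫_S |P|²`. Both are in `L²` because `S` has
    -- finite measure and `P` is bounded.
    have hu : MemLp (S.indicator fun _ => (1 : ℂ)) 2 :=
      memLp_indicator_const 2 hS 1 (Or.inr hSfin.ne)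
    have hPr : MemLp (fun x => conj (P x)) 2 (volume.restrict S) :=
      MemLp.of_bound (by fun_prop) n (ae_of_all _ fun x => by
        rw [RCLike.norm_conj]; exact norm_phaseSum_le _ _ _ _)
    have hv : MemLp (S.indicator fun x => conj (P x)) 2 := (memLp_indicator_iff_restrict hS).2 hPr
    obtain ⟨f, hf⟩ := exists_profile_eq hA (E := E) hu
      (fun x hx => Set.indicator_of_notMem (fun hx' => hx hx'.1.1) _)
    obtain ⟨g, hg⟩ := exists_profile_eq hB (E := F) (memLp_add_right hv (intVec m))
      (fun x hx => Set.indicator_of_notMem (fun hx' => hx (by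
        simpa using (mem_translate_iff _ _ _).1 hx'.1.2)) _)
    have hfk : ∀ᵐ x, cubeIndex x ≠ k → profile A (f : L2 d) x = 0 := by
      filter_upwards [hf] with x hx hxk
      rw [hx]
      exact Set.indicator_of_notMem (fun hx' => hxk hx'.2) _
    have hgk : ∀ᵐ x, cubeIndex x ≠ k - m → profile B (g : L2 d) x = 0 := by
      filter_upwards [hg] with x hx hxk
      rw [hx]
      refine Set.indicator_of_notMem (fun hx' => hxk ?_) _
      have h1 := (sub_intVec_mem_unitCube_iff _ k).2 hx'.2
      rw [← sub_intVec_mem_unitCube_iff, intVec_sub]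
      convert h1 using 1
      abel
    have h0 := (samplesOrthogonal_iff hE hF hA hB hΘA hΘB).1 h k (k - m) f g hfk hgk
    rw [inner_samplingTransform hA hB hΘA hΘB hfk hgk, sub_sub_cancel] at h0
    have hdetA := ((Matrix.isUnit_iff_isUnit_det _).1 (isUnit_transpose_inv hA)).ne_zero
    have hdetB := ((Matrix.isUnit_iff_isUnit_det _).1 (isUnit_transpose_inv hB)).ne_zero
    have hdet : ((|(A.transpose)⁻¹.det| : ℝ) : ℂ) * (|(B.transpose)⁻¹.det| : ℝ) ≠ 0 :=
      mul_ne_zero (by simpa using hdetA) (by simpa using hdetB)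
    have h2 := (mul_eq_zero.1 h0).resolve_left hdet
    have h3 : ∫ x, conj (profile A (f : L2 d) x) * profile B (g : L2 d) (x - intVec m) * P x
        = ((∫ x in S, ‖P x‖ ^ 2 : ℝ) : ℂ) := by
      rw [← integral_complex_ofReal, ← integral_indicator hS]
      refine integral_congr_ae ?_
      filter_upwards [hf, (measurePreserving_sub_right volume
        (intVec m)).quasiMeasurePreserving.ae hg] with x hx hx'
      rw [hx, hx', sub_add_cancel]
      by_cases hxS : x ∈ S
      · simp [Set.indicator_of_mem hxS, Complex.conj_mul']
      · simp [Set.indicator_of_notMem hxS]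
    rw [h3, Complex.ofReal_eq_zero, integral_eq_zero_iff_of_nonneg (fun x => sq_nonneg _)
      (by simpa using hPr.norm.integrable_sq)] at h2
    rw [← ae_restrict_iff' hS]
    filter_upwards [h2] with x hx
    simpa using hx
  filter_upwards [ae_all_iff.2 hk] with x hx hxE
  exact hx (cubeIndex x) ⟨hxE, rfl⟩

/-- Taking adjoints gives `γ_j·B' m = B⁻¹ γ_j·m`. -/
theorem sum_exp_eq_sum_chr (B : Matrix (Fin d) (Fin d) ℝ) (γ : Fin n → Space d) (s : Finset (Fin n))
    (m : Fin d → ℤ) :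
    ∑ j ∈ s, Complex.exp (-2 * Real.pi * Complex.I *
      (inner ℝ (γ j) (act (B.transpose)⁻¹ (intVec m)) : ℝ))
      = ∑ j ∈ s, chr (-act B⁻¹ (γ j)) (intVec m) := by
  refine Finset.sum_congr rfl fun j _ => ?_
  rw [inner_act, Matrix.transpose_nonsing_inv, Matrix.transpose_transpose, chr, inner_neg_left]
  push_cast
  ring_nf

theorem samplesOrthogonal_iff_forall (hE : IsBand E) (hF : IsBand F) (hA : IsUnit A)
    (hB : IsUnit B) {β γ : Fin n → Space d} (hΘA : SamplingBounded E (fun _ => A) β)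
    (hΘB : SamplingBounded F (fun _ => B) γ) :
    SamplesOrthogonal hΘA hΘB ↔ ∀ m : Fin d → ℤ,
      volume (act A.transpose '' E ∩ (fun x => x + intVec m) '' (act B.transpose '' F)) = 0 ∨
      ∀ q : Space d, ∑ j : Fin n with act B⁻¹ (γ j) - act A⁻¹ (β j) = q,
        chr (-act B⁻¹ (γ j)) (intVec m) = 0 := by
  have hAt := (Matrix.isUnit_transpose A).2 hA
  have hBt := (Matrix.isUnit_transpose B).2 hB
  constructor
  · intro h m
    refine or_iff_not_imp_left.2 fun hvol q => ?_
    set S := act A.transpose '' E ∩ (fun x => x + intVec m) '' (act B.transpose '' F) with hSdef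
    set P := phaseSum (fun j => act A⁻¹ (β j)) (fun j => act B⁻¹ (γ j)) m with hP
    have hS : MeasurableSet S :=
      ((measurableEmbedding_act hAt).measurableSet_image.2 hE.measurableSet).inter
        ((measurableEmbedding_addRight (intVec m)).measurableSet_image.2
          ((measurableEmbedding_act hBt).measurableSet_image.2 hF.measurableSet))
    have hPm : MeasurableSet {x | P x = 0} :=
      (continuous_phaseSum _ _ _).measurable (measurableSet_singleton 0)
    -- `P` vanishes only almost everywhere on `S`, while `trigPoly_coeff_eq_zero` needs vanishing at
    -- every point; cutting down to the zero set loses no measure.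
    have hpos : volume (S ∩ {x | P x = 0}) ≠ 0 := by
      refine fun h0 => hvol (measure_mono_null_ae ?_ h0)
      filter_upwards [h.phaseSum_ae_eq_zero hE hF hA hB m] with x hx hxS
      exact ⟨hxS, hx hxS⟩
    by_cases hq : q ∈ Finset.univ.image (fun j => act B⁻¹ (γ j) - act A⁻¹ (β j))
    · refine trigPoly_coeff_eq_zero _
        (fun q => ∑ j : Fin n with act B⁻¹ (γ j) - act A⁻¹ (β j) = q,
          chr (-act B⁻¹ (γ j)) (intVec m)) _ (hS.inter hPm) hpos (fun x hx => ?_) q hq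
      rw [← phaseSum_eq_sum_image (fun j => act A⁻¹ (β j)) (fun j => act B⁻¹ (γ j))]
      exact hx.2
    · rw [Finset.filter_false_of_mem, Finset.sum_empty]
      exact fun j _ hj => hq (Finset.mem_image.2 ⟨j, Finset.mem_univ j, hj⟩)
  · intro h
    refine (samplesOrthogonal_iff hE hF hA hB hΘA hΘB).2 fun k l f g hf hg => ?_
    rw [inner_samplingTransform hA hB hΘA hΘB hf hg, integral_eq_zero_of_ae, mul_zero]
    -- Under the first alternative the product of the two profiles vanishes a.e.; under the second
    -- the phase polynomial is identically zero.
    rcases h (k - l) with h0 | h0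
    · filter_upwards [profile_eq_zero hA f.2, (measurePreserving_sub_right volume
        (intVec (k - l))).quasiMeasurePreserving.ae (profile_eq_zero hB g.2),
        measure_eq_zero_iff_ae_notMem.1 h0] with x hx hx' hxS
      by_cases h1 : x ∈ act A.transpose '' E
      · have h2 : x - intVec (k - l) ∉ act B.transpose '' F := fun h2 =>
          hxS ⟨h1, (mem_translate_iff _ _ _).2 h2⟩
        simp [hx' h2]
      · simp [hx h1]
    · refine ae_of_all _ fun x => ?_
      simp only [Pi.zero_apply]
      rw [phaseSum_eq_sum_image, Finset.sum_eq_zero fun q _ => by rw [h0 q, zero_mul], mul_zero]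

end Orthogonality

end LatticeSampling

end
open LatticeSampling in
theorem theorem4 {d n : ℕ} (hn : 1 ≤ n) (E F : Set (Space d)) (hE : IsBand E) (hF : IsBand F)
    (A B : Matrix (Fin d) (Fin d) ℝ) (hA : IsUnit A) (hB : IsUnit B) (β γ : Fin n → Space d)
    (hΘA : SamplingBounded E (fun _ => A) β) (hΘB : SamplingBounded F (fun _ => B) γ) :
    (SamplesOrthogonal hΘA hΘB ↔
      ∀ m : Fin d → ℤ,
        volume ((act A.transpose '' E) ∩ ((fun x => x + intVec m) '' (act B.transpose '' F))) = 0 ∨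
        ∀ q : Space d, ∑ j : Fin n with act B⁻¹ (γ j) - act A⁻¹ (β j) = q,
          Complex.exp (-2 * Real.pi * Complex.I *
            (inner ℝ (γ j) (act (B.transpose)⁻¹ (intVec m)) : ℝ)) = 0) ∧
    (SamplesOrthogonal hΘA hΘB → volume ((act A.transpose '' E) ∩ (act B.transpose '' F)) = 0) := by
  simp only [sum_exp_eq_sum_chr B]
  have key := samplesOrthogonal_iff_forall hE hF hA hB hΘA hΘB
  refine ⟨key, fun h => ?_⟩
  rcases key.1 h 0 with h0 | h0
  · simpa [intVec_zero] using h0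
  · exfalso
    -- For `m = 0` all phases are 1, so the sum over `J_q` counts `J_q`, which is nonempty when `q`
    -- is the offset of the first index.
    have h1 := h0 (act B⁻¹ (γ ⟨0, hn⟩) - act A⁻¹ (β ⟨0, hn⟩))
    simp only [intVec_zero, chr_zero_right, Finset.sum_const, nsmul_eq_mul, mul_one,
      Nat.cast_eq_zero, Finset.card_eq_zero, Finset.filter_eq_empty_iff] at h1
    exact h1 (Finset.mem_univ (⟨0, hn⟩ : Fin n)) rfl
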